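/- Let $c>0$, $\lambda>0$, $p,q\ge 0$ with $p+q\le 1$, and let $d_j=(\cos\frac{\pi j}{2},\sin\frac{\pi j}{2})$ for $j\in\mathbb{Z}$, so that $d_{j+4}=d_j$. A particle with position $(X(t),Y(t))$ starts at the origin at time $0$ and moves with constant speed $c$; its initial direction is chosen uniformly among $d_0,d_1,d_2,d_3$. At the arrival times of a Poisson process of intensity $\lambda$ the direction changes, from $d_j$ to $d_{j+1}$ with probability $p$, to $d_{j-1}$ with probability $q$, and to $d_{j+2}$ with probability $1-p-q$; the initial direction, the Poisson process and the successive choices of turn are mutually independent. Let $I_0(x)=\sum_{k\ge 0}\frac{(x/2)^{2k}}{(k!)^2}$ be the modified Bessel function of order zero. For every $t>0$, the density on the open side $\{x+y=ct,\ |x-y|<ct\}$ of the square $\{|x+y|\le ct,\ |x-y|\le ct\}$, $$f(\eta,t)=\mathbb{P}\big(X(t)+Y(t)=ct,\ X(t)-Y(t)\in d\eta\big)/d\eta,\qquad |\eta|<ct,$$ exists and is $$f(\eta,t)=\frac{e^{-\lambda t}}{4c}\left[\frac{\lambda(p+q)}{2}\,I_0\!\left(\frac{\lambda}{c}\sqrt{pq}\,\sqrt{c^2t^2-\eta^2}\right)+\frac{\partial}{\partial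 t}I_0\!\left(\frac{\lambda}{c}\sqrt{pq}\,\sqrt{c^2t^2-\eta^2}\right)\right].$$ That is, this function is well defined and nonnegative for $|\eta|<ct$, and for every Borel set $B\subseteq(-ct,ct)$, $$\mathbb{P}\big(X(t)+Y(t)=ct,\ X(t)-Y(t)\in B\big)=\int_B f(\eta,t)\,d\eta .$$ -/

import Mathlib

open MeasureTheory ProbabilityTheory

noncomputable section

namespace PlanarMotion

/-- The modified Bessel function of the first kind of order zero,
`I₀(x) = ∑ₖ (x/2)^(2k) / (k!)²`. -/
def besselI0 (x : ℝ) : ℝ :=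
  ∑' k : ℕ, (x / 2) ^ (2 * k) / ((k.factorial : ℝ) ^ 2)

/-- The law of one change of direction, as an increment of the index `j` of the direction
`d_j = (cos (π j / 2), sin (π j / 2))`: a counter-clockwise turn `+1` with probability `p`,
a clockwise turn `-1` with probability `q`, a reversal `+2` with probability `1 - p - q`. -/
def turnLaw (p q : ℝ) : Measure ℤ :=
  ENNReal.ofReal p • Measure.dirac 1 + ENNReal.ofReal q • Measure.dirac (-1)
    + ENNReal.ofReal (1 - p - q) • Measure.dirac 2

variable {Ω : Type*}

/-- The time of the `n`-th event when `W i` is the waiting time between the `i`-th and the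
`(i+1)`-st event. -/
def arrivalTime (W : ℕ → Ω → ℝ) (n : ℕ) (ω : Ω) : ℝ :=
  ∑ i ∈ Finset.range n, W i ω

/-- The number `N(t)` of events up to time `t`. For independent exponential waiting times of
rate `lam` this is the Poisson process of intensity `lam`. -/
def eventCount (W : ℕ → Ω → ℝ) (t : ℝ) (ω : Ω) : ℕ :=
  Set.ncard {n : ℕ | 1 ≤ n ∧ arrivalTime W n ω ≤ t}

/-- The index `j` of the direction `D(t) = d_j` at time `t`; the index is an integer, with
`d_j = d_(j+4)`. It starts at `J₀` and the event number `i + 1` adds `E i` to it. -/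
def dirIndex (J₀ : Ω → ℤ) (W : ℕ → Ω → ℝ) (E : ℕ → Ω → ℤ) (t : ℝ) (ω : Ω) : ℤ :=
  J₀ ω + ∑ i ∈ Finset.range (eventCount W t ω), E i ω

/-- The abscissa `X(t)` of the particle, which starts at the origin and moves with speed `c`
in the current direction. -/
def posX (c : ℝ) (J₀ : Ω → ℤ) (W : ℕ → Ω → ℝ) (E : ℕ → Ω → ℤ) (t : ℝ) (ω : Ω) : ℝ :=
  ∫ s in (0 : ℝ)..t, c * Real.cos (Real.pi / 2 * (dirIndex J₀ W E s ω : ℝ))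

/-- The ordinate `Y(t)` of the particle. -/
def posY (c : ℝ) (J₀ : Ω → ℤ) (W : ℕ → Ω → ℝ) (E : ℕ → Ω → ℤ) (t : ℝ) (ω : Ω) : ℝ :=
  ∫ s in (0 : ℝ)..t, c * Real.sin (Real.pi / 2 * (dirIndex J₀ W E s ω : ℝ))

/-- The randomness that drives the motion: a uniform initial direction among `d_0, …, d_3`,
exponential waiting times of rate `lam` (so that the changes of direction are the arrivals of a
Poisson process of intensity `lam`), and turns with law `turnLaw p q`, all mutually
independent. -/
structure IsDriving [MeasurableSpace Ω] (P : Measure Ω) (lam p q : ℝ)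
    (J₀ : Ω → ℤ) (W : ℕ → Ω → ℝ) (E : ℕ → Ω → ℤ) : Prop where
  initial_law : HasLaw J₀ (uniformOn ({0, 1, 2, 3} : Set ℤ)) P
  waiting_law : ∀ n, HasLaw (W n) (expMeasure lam) P
  turn_law : ∀ n, HasLaw (E n) (turnLaw p q) P
  waiting_indep : iIndepFun W P
  turn_indep : iIndepFun E P
  waiting_turn_indep : IndepFun (fun ω n => W n ω) (fun ω n => E n ω) P
  initial_indep : IndepFun J₀ (fun ω => ((fun n => W n ω), (fun n => E n ω))) P

/-- The function `(η, t) ↦ I₀((lam/c) √(pq) √(c²t² - η²))`. -/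
def besselProfile (c lam p q η t : ℝ) : ℝ :=
  besselI0 (lam / c * Real.sqrt (p * q) * Real.sqrt (c ^ 2 * t ^ 2 - η ^ 2))

/-- The claimed density `f(η, t)` on an open side of the square. -/
def sideDensity (c lam p q η t : ℝ) : ℝ :=
  Real.exp (-lam * t) / (4 * c) *
    (lam * (p + q) / 2 * besselProfile c lam p q η t
      + deriv (fun s => besselProfile c lam p q η s) t)

end PlanarMotion

end

/-!
The particle is on the side `x + y = ct` at time `t` exactly when it has only moved in the
directions `d₀` and `d₁`, the only ones along which `x + y` grows at the full speed `c`. Since turns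
are never zero, such a path alternates between `d₀` and `d₁`: its turns are `+1, -1, +1, …` or
`-1, +1, …`, and `x - y` is an affine function of the total time spent in the direction that is not
the final one. That time is a sum of independent exponential waiting times, hence gamma distributed,
and the other direction contributes the probability that an independent gamma time is straddled by
`t`. With `m + 1` legs in each direction or `m + 2` and `m + 1`, the densities are the terms of the
two power series `∑ zᵐ / (m!)²` and `∑ zᵐ / (m! (m + 1)!)` at `z = λ² p q (c² t² - η²) / (4 c²)`.
The first series is the Bessel function and the second one its derivative in `z`, which produces the
time derivative in the density.
-/

noncomputable section

namespace PlanarMotion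

open scoped ENNReal

variable {Ω : Type*}

section Gamma

variable {a b r x : ℝ}

lemma measurable_gammaPDF (a r : ℝ) : Measurable (gammaPDF a r) :=
  (measurable_gammaPDFReal a r).ennreal_ofReal

lemma lintegral_eq_mul_lintegral_comp_mul_left_add {f : ℝ → ℝ≥0∞} (hf : Measurable f) {m : ℝ}
    (hm : m ≠ 0) (b : ℝ) : ∫⁻ y, f y = ENNReal.ofReal |m| * ∫⁻ x, f (m * x + b) := by
  rw [← lintegral_map (f := fun y => f (y + b)) (hf.comp (by fun_prop)) (measurable_const_mul m),
    ← smul_eq_mul, ← lintegral_smul_measure, Real.smul_map_volume_mul_left hm,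
    lintegral_add_right_eq_self]

lemma mul_gammaPDF_mul_gammaPDF (ha : 0 < a) (hb : 0 < b) (hr : 0 < r) (hx : 0 < x) {u : ℝ}
    (hu0 : u ≠ 0) (hu1 : u ≠ 1) :
    ENNReal.ofReal x * (gammaPDF a r (x * u) * gammaPDF b r (-(x * u) + x)) =
      gammaPDF (a + b) r x * betaPDF a b u := by
  have hsub : -(x * u) + x = x * (1 - u) := by ring
  rw [hsub]
  rcases hu0.lt_or_gt with h0 | h0
  · rw [gammaPDF_of_neg (mul_neg_of_pos_of_neg hx h0), betaPDF_eq_zero_of_nonpos h0.le]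
    simp
  rcases hu1.lt_or_gt with h1 | h1
  · have hv : 0 < 1 - u := sub_pos.2 h1
    have := Real.Gamma_pos_of_pos ha
    have := Real.Gamma_pos_of_pos hb
    have := Real.Gamma_pos_of_pos (add_pos ha hb)
    rw [gammaPDF_of_nonneg (mul_pos hx h0).le, gammaPDF_of_nonneg (mul_pos hx hv).le,
      gammaPDF_of_nonneg hx.le, betaPDF_of_pos_lt_one h0 h1, ← ENNReal.ofReal_mul (by positivity),
      ← ENNReal.ofReal_mul (by positivity), ← ENNReal.ofReal_mul (by positivity)]
    congr 1
    have hexp : Real.exp (-(r * x)) =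
        Real.exp (-(r * (x * u))) * Real.exp (-(r * (x * (1 - u)))) := by
      rw [← Real.exp_add]
      ring_nf
    have hpow : x ^ (a + b - 1) = x * x ^ (a - 1) * x ^ (b - 1) := by
      rw [← Real.rpow_one_add' hx.le (by simpa using ha.ne'), ← Real.rpow_add hx]
      ring_nf
    rw [Real.mul_rpow hx.le h0.le, Real.mul_rpow hx.le hv.le, hexp, hpow, Real.rpow_add hr, beta]
    field_simp
  · rw [gammaPDF_of_neg (mul_neg_of_pos_of_neg hx (sub_neg.2 h1)),
      betaPDF, betaPDFReal, if_neg (fun h => h.2.not_gt h1)]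
    simp

/-- The substitution `y = x u` turns the convolution into `gammaPDF (a + b) r x` times the total
mass of the beta density. -/
lemma gammaPDF_lconvolution_gammaPDF (ha : 0 < a) (hb : 0 < b) (hr : 0 < r) (hx : 0 < x) :
    lconvolution (gammaPDF a r) (gammaPDF b r) volume x = gammaPDF (a + b) r x := by
  have hmeas : Measurable fun y => gammaPDF a r y * gammaPDF b r (-y + x) :=
    (measurable_gammaPDF a r).mul ((measurable_gammaPDF b r).comp (by fun_prop))
  calc lconvolution (gammaPDF a r) (gammaPDF b r) volume x
    _ = ENNReal.ofReal x * ∫⁻ u, gammaPDF a r (x * u) * gammaPDF b r (-(x * u) + x) := by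
      simpa [lconvolution_def, abs_of_pos hx] using
        lintegral_eq_mul_lintegral_comp_mul_left_add hmeas hx.ne' 0
    _ = ∫⁻ u, gammaPDF (a + b) r x * betaPDF a b u := by
      rw [← lintegral_const_mul' _ _ ENNReal.ofReal_ne_top]
      refine lintegral_congr_ae ?_
      filter_upwards [Measure.ae_ne volume (0 : ℝ), Measure.ae_ne volume (1 : ℝ)] with u hu0 hu1
        using mul_gammaPDF_mul_gammaPDF ha hb hr hx hu0 hu1
    _ = gammaPDF (a + b) r x := by
      have : Measurable (betaPDF a b) := (measurable_betaPDFReal a b).ennreal_ofReal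
      rw [lintegral_const_mul _ this, lintegral_betaPDF_eq_one ha hb, mul_one]

lemma gammaMeasure_conv_gammaMeasure (ha : 0 < a) (hb : 0 < b) (hr : 0 < r) :
    (gammaMeasure a r).conv (gammaMeasure b r) = gammaMeasure (a + b) r := by
  rw [gammaMeasure, gammaMeasure,
    conv_withDensity_eq_lconvolution (measurable_gammaPDF a r) (measurable_gammaPDF b r)]
  refine withDensity_congr_ae ?_
  filter_upwards [Measure.ae_ne volume (0 : ℝ)] with x hx
  rcases hx.lt_or_gt with hx | hx
  · rw [gammaPDF_of_neg hx, lconvolution_def]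
    refine lintegral_eq_zero_of_ae_eq_zero (ae_of_all _ fun y => ?_)
    rcases lt_or_ge y 0 with hy | hy
    · simp [gammaPDF_of_neg hy]
    · simp [gammaPDF_of_neg (show -y + x < 0 by linarith)]
  · exact gammaPDF_lconvolution_gammaPDF ha hb hr hx

lemma expMeasure_Ioi (hr : 0 < r) {y : ℝ} (hy : 0 ≤ y) :
    expMeasure r (Set.Ioi y) = ENNReal.ofReal r⁻¹ * exponentialPDF r y := by
  have := isProbabilityMeasure_expMeasure hr
  rw [← ofReal_measureReal, ← Set.compl_Iic, probReal_compl_eq_one_sub measurableSet_Iic,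
    ← cdf_eq_real, cdf_expMeasure_eq hr, if_pos hy, exponentialPDF_of_nonneg hy,
    ← ENNReal.ofReal_mul (by positivity)]
  congr 1
  field_simp
  ring

lemma gammaPDF_natCast_add_one (n : ℕ) (hx : 0 ≤ x) :
    gammaPDF (n + 1) r x =
      ENNReal.ofReal (r ^ (n + 1) / n.factorial * x ^ n * Real.exp (-(r * x))) := by
  rw [gammaPDF_of_nonneg hx, Real.Gamma_nat_eq_factorial, add_sub_cancel_right, Real.rpow_natCast,
    ← Nat.cast_add_one, Real.rpow_natCast]

lemma ofReal_inv_mul_gammaPDF_natCast_add_one (hr : 0 < r) (n : ℕ) (hx : 0 ≤ x) :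
    ENNReal.ofReal r⁻¹ * gammaPDF (n + 1) r x = poissonMeasure (r * x).toNNReal {n} := by
  rw [gammaPDF_natCast_add_one n hx, poissonMeasure_singleton,
    ← ENNReal.ofReal_mul (by positivity), Real.coe_toNNReal _ (by positivity)]
  congr 1
  field_simp
  ring

lemma gammaPDF_mul_inv_mul_gammaPDF {y : ℝ} (hr : 0 < r) (k l : ℕ) (hx : 0 ≤ x) (hy : 0 ≤ y) :
    gammaPDF (k + 1) r x * (ENNReal.ofReal r⁻¹ * gammaPDF (l + 1) r y) =
      ENNReal.ofReal (r ^ (k + l + 1) / (k.factorial * l.factorial) * x ^ k * y ^ l *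
        Real.exp (-(r * (x + y)))) := by
  rw [gammaPDF_natCast_add_one k hx, gammaPDF_natCast_add_one l hy,
    ← ENNReal.ofReal_mul (by positivity), ← ENNReal.ofReal_mul (by positivity), mul_add, neg_add,
    Real.exp_add]
  congr 1
  field_simp
  ring

end Gamma

section WaitingTimes

lemma arrivalTime_succ (W : ℕ → Ω → ℝ) (n : ℕ) (ω : Ω) :
    arrivalTime W (n + 1) ω = arrivalTime W n ω + W n ω :=
  Finset.sum_range_succ _ _

lemma strictMono_arrivalTime {W : ℕ → Ω → ℝ} {ω : Ω} (hω : ∀ i, 0 < W i ω) :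
    StrictMono fun n => arrivalTime W n ω :=
  strictMono_nat_of_lt_succ fun n => by simpa [arrivalTime_succ] using hω n

lemma eq_of_arrivalTime_lt_lt {W : ℕ → Ω → ℝ} {ω : Ω} {t : ℝ} {m n : ℕ} (hω : ∀ i, 0 < W i ω)
    (hm : arrivalTime W m ω < t ∧ t < arrivalTime W (m + 1) ω)
    (hn : arrivalTime W n ω < t ∧ t < arrivalTime W (n + 1) ω) : m = n := by
  have hmono := strictMono_arrivalTime hω
  have hmn := hmono.lt_iff_lt.1 (hm.1.trans hn.2)
  have hnm := hmono.lt_iff_lt.1 (hn.1.trans hm.2)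
  lia

variable [MeasurableSpace Ω] {P : Measure Ω} {lam : ℝ} {W : ℕ → Ω → ℝ}

lemma hasLaw_sum_gammaMeasure {ι : Type*} {X : ι → Ω → ℝ} {a : ι → ℝ} (hlam : 0 < lam)
    (ha : ∀ i, 0 < a i) (hX : ∀ i, HasLaw (X i) (gammaMeasure (a i) lam) P) (hindep : iIndepFun X P)
    {s : Finset ι} (hs : s.Nonempty) :
    HasLaw (fun ω => ∑ i ∈ s, X i ω) (gammaMeasure (∑ i ∈ s, a i) lam) P := by
  induction hs using Finset.Nonempty.cons_induction with
  | singleton i => simpa using hX i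
  | cons i s hi hs ih =>
    have hsum : 0 < ∑ j ∈ s, a j := Finset.sum_pos (fun j _ => ha j) hs
    have hdisj : IndepFun (fun ω => ∑ j ∈ s, X j ω) (X i) P := by
      simpa only [Finset.sum_fn] using
        hindep.indepFun_finsetSum_of_notMem₀ (fun j => (hX j).aemeasurable) hi
    have := isProbabilityMeasure_gammaMeasure (ha i) hlam
    have := isProbabilityMeasure_gammaMeasure hsum hlam
    simp only [Finset.sum_cons]
    rw [← gammaMeasure_conv_gammaMeasure (ha i) hsum hlam]
    exact IndepFun.hasLaw_add (hX i) ih hdisj.symm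

lemma hasLaw_sum_expMeasure (hlam : 0 < lam) (hW : ∀ n, HasLaw (W n) (expMeasure lam) P)
    (hindep : iIndepFun W P) {s : Finset ℕ} (hs : s.Nonempty) :
    HasLaw (fun ω => ∑ i ∈ s, W i ω) (gammaMeasure s.card lam) P := by
  simpa using hasLaw_sum_gammaMeasure hlam (fun _ => one_pos) hW hindep hs

lemma ae_waiting_pos (hW : ∀ n, HasLaw (W n) (expMeasure lam) P) : ∀ᵐ ω ∂P, ∀ n, 0 < W n ω := by
  refine ae_all_iff.2 fun n => ((hW n).ae_iff measurableSet_Ioi.mem).2 ?_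
  rw [expMeasure, gammaMeasure, ae_withDensity_iff (measurable_gammaPDF 1 lam)]
  filter_upwards [Measure.ae_ne volume (0 : ℝ)] with x hx hdensity
  exact lt_of_not_ge fun hle => hdensity (gammaPDF_of_neg (hle.lt_of_ne hx))

lemma aemeasurable_arrivalTime (hW : ∀ n, AEMeasurable (W n) P) (n : ℕ) :
    AEMeasurable (arrivalTime W n) P :=
  Finset.aemeasurable_fun_sum _ fun i _ => hW i

lemma measure_prodMk_mem [IsFiniteMeasure P] {α β : Type*} [MeasurableSpace α] [MeasurableSpace β]
    {X : Ω → α} {Y : Ω → β} (hXY : IndepFun X Y P) (hX : AEMeasurable X P) (hY : AEMeasurable Y P)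
    {S : Set (α × β)} (hS : MeasurableSet S) :
    P {ω | (X ω, Y ω) ∈ S} = ∫⁻ x, P {ω | (x, Y ω) ∈ S} ∂(P.map X) := by
  change P ((fun ω => (X ω, Y ω)) ⁻¹' S) = _
  rw [← Measure.map_apply_of_aemeasurable (hX.prodMk hY) hS,
    (indepFun_iff_map_prod_eq_prod_map_map hX hY).1 hXY, Measure.prod_apply hS]
  exact lintegral_congr fun x => Measure.map_apply_of_aemeasurable hY (measurable_prodMk_left hS)

/-- Conditioning on `U`: the interval `(U + V, U + V + T)` straddles `t` iff `(V, V + T)`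
straddles `t - U`. -/
lemma measure_mem_and_add_lt_lt [IsFiniteMeasure P] {U V T : Ω → ℝ} {a r t : ℝ}
    {g : ℝ → ℝ≥0∞} {C : Set ℝ}
    (hU : HasLaw U (gammaMeasure a r) P) (hV : AEMeasurable V P) (hT : AEMeasurable T P)
    (hindep : IndepFun U (fun ω => (V ω, T ω)) P)
    (hg : ∀ y, 0 < y → P {ω | V ω < y ∧ y < V ω + T ω} = g y)
    (hC : MeasurableSet C) (hCt : C ⊆ Set.Iio t) :
    P {ω | U ω ∈ C ∧ U ω + V ω < t ∧ t < U ω + V ω + T ω} =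
      ∫⁻ u in C, gammaPDF a r u * g (t - u) := by
  have hS : MeasurableSet {z : ℝ × ℝ × ℝ | z.1 ∈ C ∧ z.1 + z.2.1 < t ∧ t < z.1 + z.2.1 + z.2.2} :=
    (measurable_fst hC).inter
      ((measurableSet_lt (f := fun z : ℝ × ℝ × ℝ => z.1 + z.2.1) (by fun_prop) (by fun_prop)).inter
        (measurableSet_lt (g := fun z : ℝ × ℝ × ℝ => z.1 + z.2.1 + z.2.2) (by fun_prop)
          (by fun_prop)))
  have hfiber : ∀ u, P {ω | u ∈ C ∧ u + V ω < t ∧ t < u + V ω + T ω} =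
      C.indicator (fun u => g (t - u)) u := by
    intro u
    by_cases hu : u ∈ C
    · rw [Set.indicator_of_mem hu, ← hg _ (sub_pos.2 (hCt hu))]
      simp only [hu, true_and, lt_sub_iff_add_lt', sub_lt_iff_lt_add', add_assoc]
    · simp [hu]
  calc P {ω | U ω ∈ C ∧ U ω + V ω < t ∧ t < U ω + V ω + T ω}
    _ = ∫⁻ u, P {ω | u ∈ C ∧ u + V ω < t ∧ t < u + V ω + T ω} ∂(P.map U) :=
      measure_prodMk_mem hindep hU.aemeasurable (hV.prodMk hT) hS
    _ = ∫⁻ u in C, g (t - u) ∂(gammaMeasure a r) := by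
      rw [hU.map_eq, lintegral_congr hfiber, lintegral_indicator hC]
    _ = ∫⁻ u in C, gammaPDF a r u * g (t - u) :=
      setLIntegral_withDensity_eq_setLIntegral_mul_non_measurable _ (measurable_gammaPDF a r) _ hC
        (ae_of_all _ fun _ => ENNReal.ofReal_lt_top)

variable [IsProbabilityMeasure P]

lemma measure_sum_lt_lt (hlam : 0 < lam) (hW : ∀ n, HasLaw (W n) (expMeasure lam) P)
    (hindep : iIndepFun W P) {s : Finset ℕ} {n : ℕ} (hn : n ∉ s) {x : ℝ} (hx : 0 < x) :
    P {ω | ∑ i ∈ s, W i ω < x ∧ x < ∑ i ∈ s, W i ω + W n ω} =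
      ENNReal.ofReal lam⁻¹ * gammaPDF (s.card + 1) lam x := by
  have hexp : ∀ y, 0 < y → P {ω | (0 : ℝ) < y ∧ y < 0 + W n ω} =
      ENNReal.ofReal lam⁻¹ * gammaPDF 1 lam y := by
    intro y hy
    simp only [hy, true_and, zero_add]
    exact ((hW n).measure_eq measurableSet_Ioi).trans (expMeasure_Ioi hlam hy.le)
  rcases s.eq_empty_or_nonempty with rfl | hs
  · simpa using hexp x hx
  have hcard : (0 : ℝ) < s.card := by exact_mod_cast hs.card_pos
  have hsum_indep : IndepFun (fun ω => ∑ i ∈ s, W i ω) (fun ω => ((0 : ℝ), W n ω)) P := by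
    have := hindep.indepFun_finsetSum_of_notMem₀ (fun i => (hW i).aemeasurable) hn
    simp only [Finset.sum_fn] at this
    exact this.comp measurable_id measurable_prodMk_left
  calc P {ω | ∑ i ∈ s, W i ω < x ∧ x < ∑ i ∈ s, W i ω + W n ω}
    _ = ∫⁻ u in Set.Iio x, gammaPDF s.card lam u *
          (ENNReal.ofReal lam⁻¹ * gammaPDF 1 lam (x - u)) := by
      rw [← measure_mem_and_add_lt_lt (hasLaw_sum_expMeasure hlam hW hindep hs) aemeasurable_const
        (hW n).aemeasurable hsum_indep hexp measurableSet_Iio subset_rfl]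
      congr 1
      ext ω
      simp +contextual
    _ = ∫⁻ u, ENNReal.ofReal lam⁻¹ * (gammaPDF s.card lam u * gammaPDF 1 lam (-u + x)) := by
      rw [← lintegral_indicator measurableSet_Iio]
      refine lintegral_congr_ae ?_
      filter_upwards [Measure.ae_ne volume x] with u hu
      rcases hu.lt_or_gt with hu | hu
      · rw [Set.indicator_of_mem (Set.mem_Iio.2 hu), mul_left_comm, sub_eq_neg_add]
      · rw [Set.indicator_of_notMem (by simpa using hu.le),
          gammaPDF_of_neg (show -u + x < 0 by linarith)]
        simp
    _ = ENNReal.ofReal lam⁻¹ * gammaPDF (s.card + 1) lam x := by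
      rw [lintegral_const_mul' _ _ ENNReal.ofReal_ne_top, ← lconvolution_def,
        gammaPDF_lconvolution_gammaPDF hcard one_pos hlam hx]

lemma measure_sum_mem_and_add_sum_lt_lt (hlam : 0 < lam)
    (hW : ∀ n, HasLaw (W n) (expMeasure lam) P) (hindep : iIndepFun W P) {s s' : Finset ℕ} {n : ℕ}
    (hs : s.Nonempty) (hss' : Disjoint s s') (hns : n ∉ s) (hns' : n ∉ s') {t : ℝ} {C : Set ℝ}
    (hC : MeasurableSet C) (hCt : C ⊆ Set.Iio t) :
    P {ω | ∑ i ∈ s, W i ω ∈ C ∧ ∑ i ∈ s, W i ω + ∑ i ∈ s', W i ω < t ∧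
        t < ∑ i ∈ s, W i ω + ∑ i ∈ s', W i ω + W n ω} =
      ∫⁻ u in C, gammaPDF s.card lam u *
        (ENNReal.ofReal lam⁻¹ * gammaPDF (s'.card + 1) lam (t - u)) := by
  have hWm := fun i => (hW i).aemeasurable
  have hpair : IndepFun (fun ω => ∑ i ∈ s, W i ω) (fun ω => (∑ i ∈ s', W i ω, W n ω)) P := by
    have hblocks := hindep.indepFun_finset₀ s (insert n s')
      (Finset.disjoint_insert_right.2 ⟨hns, hss'⟩) hWm
    have hleft : Measurable fun w : s → ℝ => ∑ i : s, w i := by fun_prop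
    have hright : Measurable fun w : ↥(insert n s') → ℝ =>
        (∑ i : s', w ⟨i.1, Finset.mem_insert_of_mem i.2⟩, w ⟨n, Finset.mem_insert_self n s'⟩) := by
      fun_prop
    convert hblocks.comp hleft hright using 2 with ω ω
    · exact (Finset.sum_coe_sort s fun i => W i ω).symm
    · exact congrArg (·, W n ω) (Finset.sum_coe_sort s' fun i => W i ω).symm
  exact measure_mem_and_add_lt_lt (hasLaw_sum_expMeasure hlam hW hindep hs)
    (Finset.aemeasurable_fun_sum _ fun i _ => hWm i) (hWm n) hpair
    (fun y hy => measure_sum_lt_lt hlam hW hindep hns' hy) hC hCt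

lemma measure_arrivalTime_lt_lt (hlam : 0 < lam) (hW : ∀ n, HasLaw (W n) (expMeasure lam) P)
    (hindep : iIndepFun W P) {t : ℝ} (ht : 0 < t) (n : ℕ) :
    P {ω | arrivalTime W n ω < t ∧ t < arrivalTime W (n + 1) ω} =
      poissonMeasure (lam * t).toNNReal {n} := by
  simp only [arrivalTime_succ]
  rw [← ofReal_inv_mul_gammaPDF_natCast_add_one hlam n ht.le]
  simpa [arrivalTime] using measure_sum_lt_lt hlam hW hindep (Finset.notMem_range_self (n := n)) ht

lemma ae_exists_arrivalTime_lt_lt (hlam : 0 < lam) (hW : ∀ n, HasLaw (W n) (expMeasure lam) P)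
    (hindep : iIndepFun W P) {t : ℝ} (ht : 0 < t) :
    ∀ᵐ ω ∂P, ∃ n, arrivalTime W n ω < t ∧ t < arrivalTime W (n + 1) ω := by
  have hTm := aemeasurable_arrivalTime (P := P) fun n => (hW n).aemeasurable
  set A : ℕ → Set Ω := fun n => {ω | arrivalTime W n ω < t ∧ t < arrivalTime W (n + 1) ω}
  have hA : ∀ n, NullMeasurableSet (A n) P := fun n =>
    (nullMeasurableSet_lt (hTm n) aemeasurable_const).inter
      (nullMeasurableSet_lt aemeasurable_const (hTm (n + 1)))
  have hdisj : Pairwise (Function.onFun (AEDisjoint P) A) := fun m n hmn => by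
    refine measure_mono_null (fun ω hω => ?_) (ae_iff.1 (ae_waiting_pos hW))
    intro hpos
    exact hmn (eq_of_arrivalTime_lt_lt hpos hω.1 hω.2)
  have hmass : P (⋃ n, A n) = 1 := by
    rw [measure_iUnion₀ hdisj hA, tsum_congr (measure_arrivalTime_lt_lt hlam hW hindep ht)]
    simpa using (poissonMeasure (lam * t).toNNReal).tsum_indicator_apply_singleton Set.univ .univ
  filter_upwards [(mem_ae_iff_prob_eq_one₀ (.iUnion hA)).2 hmass] with ω hω
  exact Set.mem_iUnion.1 hω

end WaitingTimes

section Paths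

/-- The index of the direction after the first `k` events. -/
def dirAfter (J₀ : Ω → ℤ) (E : ℕ → Ω → ℤ) (k : ℕ) (ω : Ω) : ℤ :=
  J₀ ω + ∑ i ∈ Finset.range k, E i ω

/-- The time that the particle spends before time `t` on its `k`-th leg, the one between the
events number `k` and `k + 1`; it is `0` on the legs that start after `t`. -/
def sojourn (W : ℕ → Ω → ℝ) (t : ℝ) (k : ℕ) (ω : Ω) : ℝ :=
  min (arrivalTime W (k + 1) ω) t - min (arrivalTime W k ω) t

variable {J₀ : Ω → ℤ} {W : ℕ → Ω → ℝ} {E : ℕ → Ω → ℤ} {ω : Ω} {t c : ℝ} {n : ℕ}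

lemma eventCount_eq (hω : ∀ i, 0 < W i ω) (hn : arrivalTime W n ω ≤ t)
    (hn' : t < arrivalTime W (n + 1) ω) : eventCount W t ω = n := by
  have hmono := strictMono_arrivalTime hω
  have hset : {k : ℕ | 1 ≤ k ∧ arrivalTime W k ω ≤ t} = Set.Icc 1 n := by
    ext k
    refine and_congr_right fun _ => ⟨fun hk => ?_, fun hk => (hmono.monotone hk).trans hn⟩
    exact Nat.lt_succ_iff.1 (hmono.lt_iff_lt.1 (hk.trans_lt hn'))
  rw [eventCount, hset, Set.ncard_eq_toFinset_card', Set.toFinset_Icc, Nat.card_Icc,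
    add_tsub_cancel_right]

lemma dirIndex_eqOn_Ioo (hω : ∀ i, 0 < W i ω) (k : ℕ) :
    Set.EqOn (fun s => dirIndex J₀ W E s ω) (fun _ => dirAfter J₀ E k ω)
      (Set.Ioo (min (arrivalTime W k ω) t) (min (arrivalTime W (k + 1) ω) t)) := by
  rintro s ⟨hks, hsk⟩
  obtain ⟨hsk, hst⟩ := lt_min_iff.1 hsk
  have hks : arrivalTime W k ω < s := (min_lt_iff.1 hks).resolve_right hst.not_gt
  simp only [dirIndex, dirAfter, eventCount_eq hω hks.le hsk]

lemma min_arrivalTime_le_succ (hω : ∀ i, 0 < W i ω) (t : ℝ) (k : ℕ) :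
    min (arrivalTime W k ω) t ≤ min (arrivalTime W (k + 1) ω) t :=
  min_le_min_right _ ((strictMono_arrivalTime hω).monotone k.le_succ)

lemma integral_comp_dirIndex (hω : ∀ i, 0 < W i ω) (ht : 0 ≤ t) (htn : t ≤ arrivalTime W n ω)
    (G : ℤ → ℝ) :
    ∫ s in (0 : ℝ)..t, G (dirIndex J₀ W E s ω) =
      ∑ k ∈ Finset.range n, G (dirAfter J₀ E k ω) * sojourn W t k ω := by
  have hconst : ∀ k, Set.EqOn (fun s => G (dirIndex J₀ W E s ω)) (fun _ => G (dirAfter J₀ E k ω))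
      (Set.Ioo (min (arrivalTime W k ω) t) (min (arrivalTime W (k + 1) ω) t)) := fun k s hs =>
    congrArg G (dirIndex_eqOn_Ioo hω k hs)
  have hint : ∀ k < n, IntervalIntegrable (fun s => G (dirIndex J₀ W E s ω)) volume
      (min (arrivalTime W k ω) t) (min (arrivalTime W (k + 1) ω) t) := fun k _ =>
    (intervalIntegrable_congr_uIoo
      (by rw [Set.uIoo_of_le (min_arrivalTime_le_succ hω t k)]; exact hconst k)).2
      intervalIntegrable_const
  have hsum := intervalIntegral.sum_integral_adjacent_intervals hint
  have h0 : min (arrivalTime W 0 ω) t = 0 := by simpa [arrivalTime] using ht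
  rw [h0, min_eq_right htn] at hsum
  rw [← hsum]
  refine Finset.sum_congr rfl fun k _ => ?_
  rw [intervalIntegral.integral_congr_Ioo_of_le (min_arrivalTime_le_succ hω t k) (hconst k),
    intervalIntegral.integral_const, smul_eq_mul, mul_comm, sojourn]

lemma sum_sojourn (ht : 0 ≤ t) (htn : t ≤ arrivalTime W n ω) :
    ∑ k ∈ Finset.range n, sojourn W t k ω = t := by
  simp only [sojourn]
  rw [Finset.sum_range_sub fun k => min (arrivalTime W k ω) t, min_eq_right htn]
  simpa [arrivalTime] using ht

lemma sojourn_eq_waiting {k : ℕ} (hω : ∀ i, 0 < W i ω) (hn : arrivalTime W n ω ≤ t) (hkn : k < n) :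
    sojourn W t k ω = W k ω := by
  have hmono : Monotone fun k => arrivalTime W k ω := (strictMono_arrivalTime hω).monotone
  have hk : arrivalTime W k ω ≤ t := (hmono hkn.le).trans hn
  have hk' : arrivalTime W (k + 1) ω ≤ t := (hmono (Nat.succ_le_of_lt hkn)).trans hn
  rw [sojourn, min_eq_left hk, min_eq_left hk', arrivalTime_succ, add_sub_cancel_left]

lemma sojourn_pos {k : ℕ} (hω : ∀ i, 0 < W i ω) (hn : arrivalTime W n ω < t) (hkn : k ≤ n) :
    0 < sojourn W t k ω := by
  have hmono := strictMono_arrivalTime hω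
  have hk : arrivalTime W k ω < t := (hmono.monotone hkn).trans_lt hn
  rw [sojourn, min_eq_left hk.le, sub_pos]
  exact lt_min (hmono k.lt_succ_self) hk

lemma cos_half_pi_mul_intCast (j : ℤ) :
    Real.cos (Real.pi / 2 * j) = if j % 4 = 0 then 1 else if j % 4 = 2 then -1 else 0 := by
  have hj : Real.pi / 2 * (j : ℝ) = Real.pi / 2 * (j % 4 : ℤ) + (j / 4 : ℤ) * (2 * Real.pi) := by
    conv_lhs => rw [← Int.emod_add_mul_ediv j 4]
    push_cast
    ring
  rw [hj, Real.cos_add_int_mul_two_pi]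
  obtain h | h | h | h : j % 4 = 0 ∨ j % 4 = 1 ∨ j % 4 = 2 ∨ j % 4 = 3 := by lia
  all_goals rw [h]
  · simp
  · simp
  · simp
  · rw [show Real.pi / 2 * ((3 : ℤ) : ℝ) = Real.pi / 2 + Real.pi by push_cast; ring,
      Real.cos_add_pi]
    simp

lemma sin_half_pi_mul_intCast (j : ℤ) :
    Real.sin (Real.pi / 2 * j) = if j % 4 = 1 then 1 else if j % 4 = 3 then -1 else 0 := by
  have hj : Real.pi / 2 * (j : ℝ) = Real.pi / 2 * (j - 1 : ℤ) + Real.pi / 2 := by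
    push_cast
    ring
  rw [hj, Real.sin_add_pi_div_two, cos_half_pi_mul_intCast]
  split_ifs <;> first | rfl | lia

lemma cos_add_sin_half_pi_mul_le_one (j : ℤ) :
    Real.cos (Real.pi / 2 * j) + Real.sin (Real.pi / 2 * j) ≤ 1 := by
  rw [cos_half_pi_mul_intCast, sin_half_pi_mul_intCast]
  split_ifs <;> first | lia | norm_num

lemma cos_add_sin_half_pi_mul_eq_one_iff (j : ℤ) :
    Real.cos (Real.pi / 2 * j) + Real.sin (Real.pi / 2 * j) = 1 ↔ j % 4 = 0 ∨ j % 4 = 1 := by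
  rw [cos_half_pi_mul_intCast, sin_half_pi_mul_intCast]
  split_ifs <;> first | lia | norm_num [*]

lemma posX_add_posY_eq_iff (hc : 0 < c) (hω : ∀ i, 0 < W i ω) (ht : 0 ≤ t)
    (hn : arrivalTime W n ω < t) (hn' : t < arrivalTime W (n + 1) ω) :
    posX c J₀ W E t ω + posY c J₀ W E t ω = c * t ↔
      ∀ k ≤ n, dirAfter J₀ E k ω % 4 = 0 ∨ dirAfter J₀ E k ω % 4 = 1 := by
  set u : ℕ → ℝ := fun k => Real.cos (Real.pi / 2 * (dirAfter J₀ E k ω : ℝ)) +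
    Real.sin (Real.pi / 2 * (dirAfter J₀ E k ω : ℝ)) with hu
  have hsum : posX c J₀ W E t ω + posY c J₀ W E t ω =
      ∑ k ∈ Finset.range (n + 1), c * (u k * sojourn W t k ω) := by
    rw [posX, posY, integral_comp_dirIndex hω ht hn'.le fun j => c * Real.cos (Real.pi / 2 * j),
      integral_comp_dirIndex hω ht hn'.le fun j => c * Real.sin (Real.pi / 2 * j),
      ← Finset.sum_add_distrib]
    exact Finset.sum_congr rfl fun k _ => by simp only [hu]; ring
  have htotal : c * t = ∑ k ∈ Finset.range (n + 1), c * sojourn W t k ω := by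
    rw [← Finset.mul_sum, sum_sojourn ht hn'.le]
  have hpos : ∀ k ∈ Finset.range (n + 1), 0 < sojourn W t k ω := fun k hk =>
    sojourn_pos hω hn (Finset.mem_range_succ_iff.1 hk)
  have hle : ∀ k ∈ Finset.range (n + 1), c * (u k * sojourn W t k ω) ≤ c * sojourn W t k ω :=
    fun k hk => mul_le_mul_of_nonneg_left
      (mul_le_of_le_one_left (hpos k hk).le (cos_add_sin_half_pi_mul_le_one _)) hc.le
  rw [hsum, htotal, Finset.sum_eq_sum_iff_of_le hle]
  refine forall_congr' fun k => ⟨fun h hk => ?_, fun h hk => ?_⟩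
  · have hk := Finset.mem_range_succ_iff.2 hk
    refine (cos_add_sin_half_pi_mul_eq_one_iff _).1 ?_
    exact (mul_eq_right₀ (hpos k hk).ne').1 (mul_left_cancel₀ hc.ne' (h hk))
  · have hk' := (cos_add_sin_half_pi_mul_eq_one_iff _).2 (h (Finset.mem_range_succ_iff.1 hk))
    simp only [hu, hk', one_mul]

end Paths

section Zigzag

/-- The initial direction is `d_a` and the first `n` turns are alternately `+1` and `-1`, starting
with `+1` if `a` is even. For `a ∈ {0, 1}` these are the paths that only use `d_0` and `d_1`. -/
structure IsZigzag (J₀ : Ω → ℤ) (E : ℕ → Ω → ℤ) (a n : ℕ) (ω : Ω) : Prop where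
  initial_eq : J₀ ω = a
  turn_eq : ∀ k < n, E k ω = (-1) ^ (k + a)

/-- The events `k < n` whose following leg is perpendicular to the last of the legs numbered
`0, …, n` on a zigzag path. -/
def oppositeIndices (n : ℕ) : Finset ℕ := {k ∈ Finset.range n | Odd (k + n)}

/-- The events `k < n` whose following leg is parallel to the last of the legs numbered `0, …, n`
on a zigzag path. -/
def sameIndices (n : ℕ) : Finset ℕ := {k ∈ Finset.range n | Even (k + n)}

/-- The value of `X(t) - Y(t)` on a zigzag path with initial direction `d_a` and `n` turns before
time `t`, in terms of the total time `x` spent in the direction other than the final one. -/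
def sideCoord (c t : ℝ) (a n : ℕ) (x : ℝ) : ℝ := c * (-1) ^ (n + a) * (t - 2 * x)

/-- The inverse of `sideCoord`. -/
def oppositeTime (c t : ℝ) (a n : ℕ) (η : ℝ) : ℝ := (t - (-1) ^ (n + a) * η / c) / 2

lemma oppositeIndices_succ (n : ℕ) : oppositeIndices (n + 1) = insert n (sameIndices n) := by
  ext k
  simp only [oppositeIndices, sameIndices, Finset.mem_filter, Finset.mem_range, Finset.mem_insert]
  grind

lemma sameIndices_succ (n : ℕ) : sameIndices (n + 1) = oppositeIndices n := by
  ext k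
  simp only [oppositeIndices, sameIndices, Finset.mem_filter, Finset.mem_range]
  grind

lemma card_sameIndices_and_card_oppositeIndices (n : ℕ) :
    (sameIndices n).card = n / 2 ∧ (oppositeIndices n).card = (n + 1) / 2 := by
  induction n with
  | zero => simp [oppositeIndices, sameIndices]
  | succ n ih =>
    have hn : n ∉ sameIndices n := by simp [sameIndices]
    rw [sameIndices_succ, oppositeIndices_succ, Finset.card_insert_of_notMem hn, ih.1, ih.2]
    lia

lemma disjoint_oppositeIndices_sameIndices (n : ℕ) :
    Disjoint (oppositeIndices n) (sameIndices n) :=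
  Finset.disjoint_filter.2 fun _ _ hodd heven => Nat.not_odd_iff_even.2 heven hodd

lemma sum_oppositeIndices_add_sum_sameIndices (n : ℕ) (w : ℕ → ℝ) :
    ∑ i ∈ oppositeIndices n, w i + ∑ i ∈ sameIndices n, w i = ∑ i ∈ Finset.range n, w i := by
  simp only [oppositeIndices, sameIndices, ← Nat.not_odd_iff_even]
  exact Finset.sum_filter_add_sum_filter_not _ _ _

variable {J₀ : Ω → ℤ} {W : ℕ → Ω → ℝ} {E : ℕ → Ω → ℤ} {ω : Ω} {t c : ℝ} {a n : ℕ}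

lemma dirAfter_succ (k : ℕ) : dirAfter J₀ E (k + 1) ω = dirAfter J₀ E k ω + E k ω := by
  rw [dirAfter, dirAfter, Finset.sum_range_succ, add_assoc]

lemma IsZigzag.dirAfter_eq (h : IsZigzag J₀ E a n ω) (ha : a < 2) {k : ℕ} (hk : k ≤ n) :
    dirAfter J₀ E k ω = ((k + a : ℕ) : ℤ) % 2 := by
  induction k with
  | zero => simp only [dirAfter, Finset.sum_range_zero, h.initial_eq]; lia
  | succ k ih =>
    rw [dirAfter_succ, ih (by lia), h.turn_eq k hk]
    rcases Nat.even_or_odd (k + a) with hka | hka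
    · rw [hka.neg_one_pow]
      grind
    · rw [hka.neg_one_pow]
      grind

lemma forall_dirAfter_emod_four_iff_exists_isZigzag (hJ : J₀ ω ∈ ({0, 1, 2, 3} : Set ℤ))
    (hE : ∀ k, E k ω ∈ ({1, -1, 2} : Set ℤ)) (n : ℕ) :
    (∀ k ≤ n, dirAfter J₀ E k ω % 4 = 0 ∨ dirAfter J₀ E k ω % 4 = 1) ↔
      ∃ a : Fin 2, IsZigzag J₀ E a n ω := by
  refine ⟨fun h => ?_, fun ⟨a, ha⟩ k hk => by rw [ha.dirAfter_eq a.2 hk]; lia⟩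
  have hstart : J₀ ω = 0 ∨ J₀ ω = 1 := by
    have h0 := h 0 n.zero_le
    simp only [dirAfter, Finset.sum_range_zero, add_zero] at h0
    simp only [Set.mem_insert_iff, Set.mem_singleton_iff] at hJ
    lia
  obtain ⟨a, ha⟩ : ∃ a : Fin 2, J₀ ω = (a : ℕ) := by
    rcases hstart with h0 | h0
    · exact ⟨0, h0⟩
    · exact ⟨1, h0⟩
  refine ⟨a, ha, fun k => Nat.strong_induction_on k fun k ih hk => ?_⟩
  have hz : IsZigzag J₀ E a k ω := ⟨ha, fun i hi => ih i hi (hi.trans hk)⟩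
  have hnext := h (k + 1) hk
  have hturn := hE k
  simp only [Set.mem_insert_iff, Set.mem_singleton_iff] at hturn
  rw [dirAfter_succ, hz.dirAfter_eq a.2 le_rfl] at hnext
  rcases Nat.even_or_odd (k + a) with hka | hka
  · rw [hka.neg_one_pow]
    grind
  · rw [hka.neg_one_pow]
    grind

lemma IsZigzag.initial_unique {a b : Fin 2} {m : ℕ} (ha : IsZigzag J₀ E a m ω)
    (hb : IsZigzag J₀ E b n ω) : a = b :=
  Fin.ext (by exact_mod_cast ha.initial_eq.symm.trans hb.initial_eq)

lemma cos_sub_sin_half_pi_mul_emod_two (m : ℕ) :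
    Real.cos (Real.pi / 2 * (((m : ℤ) % 2 : ℤ) : ℝ)) -
      Real.sin (Real.pi / 2 * (((m : ℤ) % 2 : ℤ) : ℝ)) = (-1) ^ m := by
  rcases Nat.even_or_odd m with hm | hm
  · rw [show (m : ℤ) % 2 = 0 by grind, hm.neg_one_pow]
    simp
  · rw [show (m : ℤ) % 2 = 1 by grind, hm.neg_one_pow]
    simp

lemma neg_one_pow_mul_one_sub_two_mul_ite (a k n : ℕ) :
    (-1 : ℝ) ^ (n + a) * (1 - 2 * if Odd (k + n) then 1 else 0) = (-1) ^ (k + a) := by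
  have hsign : (1 - 2 * if Odd (k + n) then 1 else 0 : ℝ) = (-1) ^ (k + n) := by
    rcases Nat.even_or_odd (k + n) with h | h
    · rw [if_neg (Nat.not_odd_iff_even.2 h), h.neg_one_pow]
      norm_num
    · rw [if_pos h, h.neg_one_pow]
      norm_num
  rw [hsign, ← pow_add, show n + a + (k + n) = k + a + 2 * n by ring, pow_add, pow_mul]
  norm_num

lemma sum_sojourn_odd (hω : ∀ i, 0 < W i ω) (hn : arrivalTime W n ω ≤ t) :
    ∑ k ∈ Finset.range (n + 1), (if Odd (k + n) then sojourn W t k ω else 0) =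
      ∑ i ∈ oppositeIndices n, W i ω := by
  rw [Finset.sum_range_succ, if_neg (by simp), add_zero, ← Finset.sum_filter]
  exact Finset.sum_congr rfl fun k hk =>
    sojourn_eq_waiting hω hn (Finset.mem_range.1 (Finset.mem_filter.1 hk).1)

lemma IsZigzag.posX_sub_posY_eq (h : IsZigzag J₀ E a n ω) (ha : a < 2) (hω : ∀ i, 0 < W i ω)
    (ht : 0 ≤ t) (hn : arrivalTime W n ω ≤ t) (hn' : t < arrivalTime W (n + 1) ω) :
    posX c J₀ W E t ω - posY c J₀ W E t ω =
      sideCoord c t a n (∑ i ∈ oppositeIndices n, W i ω) := by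
  have hdir : ∀ k ∈ Finset.range (n + 1),
      c * Real.cos (Real.pi / 2 * (dirAfter J₀ E k ω : ℝ)) * sojourn W t k ω -
        c * Real.sin (Real.pi / 2 * (dirAfter J₀ E k ω : ℝ)) * sojourn W t k ω =
      c * (-1) ^ (k + a) * sojourn W t k ω := fun k hk => by
    rw [h.dirAfter_eq ha (Finset.mem_range_succ_iff.1 hk), ← cos_sub_sin_half_pi_mul_emod_two]
    ring
  calc posX c J₀ W E t ω - posY c J₀ W E t ω
    _ = ∑ k ∈ Finset.range (n + 1), c * (-1) ^ (k + a) * sojourn W t k ω := by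
      rw [posX, posY, integral_comp_dirIndex hω ht hn'.le fun j => c * Real.cos (Real.pi / 2 * j),
        integral_comp_dirIndex hω ht hn'.le fun j => c * Real.sin (Real.pi / 2 * j),
        ← Finset.sum_sub_distrib, Finset.sum_congr rfl hdir]
    _ = c * (-1) ^ (n + a) * (∑ k ∈ Finset.range (n + 1), sojourn W t k ω -
          2 * ∑ k ∈ Finset.range (n + 1), if Odd (k + n) then sojourn W t k ω else 0) := by
      rw [Finset.mul_sum, ← Finset.sum_sub_distrib, Finset.mul_sum]
      refine Finset.sum_congr rfl fun k _ => ?_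
      rw [← neg_one_pow_mul_one_sub_two_mul_ite a k n]
      split_ifs <;> ring
    _ = sideCoord c t a n (∑ i ∈ oppositeIndices n, W i ω) := by
      rw [sum_sojourn ht hn'.le, sum_sojourn_odd hω hn, sideCoord]

end Zigzag

section RegularPaths

variable {J₀ : Ω → ℤ} {W : ℕ → Ω → ℝ} {E : ℕ → Ω → ℤ} {ω : Ω} {t c : ℝ}

/-- The properties of a driving path that hold almost surely and that the pathwise arguments use:
in particular, time `t` lies strictly between two consecutive events. -/
structure IsRegularPath (J₀ : Ω → ℤ) (W : ℕ → Ω → ℝ) (E : ℕ → Ω → ℤ) (t : ℝ) (ω : Ω) : Prop where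
  waiting_pos : ∀ i, 0 < W i ω
  exists_arrivalTime_lt_lt : ∃ n, arrivalTime W n ω < t ∧ t < arrivalTime W (n + 1) ω
  initial_mem : J₀ ω ∈ ({0, 1, 2, 3} : Set ℤ)
  turn_mem : ∀ k, E k ω ∈ ({1, -1, 2} : Set ℤ)

/-- Before time `t` there are exactly `n` turns, the path is a zigzag starting in direction `d_a`,
and the time spent in the direction other than the final one belongs to `C`. -/
def zigzagEvent (J₀ : Ω → ℤ) (W : ℕ → Ω → ℝ) (E : ℕ → Ω → ℤ) (t : ℝ) (a n : ℕ) (C : Set ℝ) :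
    Set Ω :=
  {ω | IsZigzag J₀ E a n ω ∧ ∑ i ∈ oppositeIndices n, W i ω ∈ C ∧
    arrivalTime W n ω < t ∧ t < arrivalTime W (n + 1) ω}

/-- A path without turns ends at a vertex of the square, outside the open side. -/
lemma IsRegularPath.posX_posY_mem_side_iff (hω : IsRegularPath J₀ W E t ω) (hc : 0 < c)
    (ht : 0 ≤ t) {B : Set ℝ} (hB : B ⊆ Set.Ioo (-(c * t)) (c * t)) :
    (posX c J₀ W E t ω + posY c J₀ W E t ω = c * t ∧ posX c J₀ W E t ω - posY c J₀ W E t ω ∈ B) ↔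
      ∃ i : ℕ × Fin 2,
        ω ∈ zigzagEvent J₀ W E t i.2 (i.1 + 1) (sideCoord c t i.2 (i.1 + 1) ⁻¹' B) := by
  constructor
  · rintro ⟨hside, hmem⟩
    obtain ⟨n, hn, hn'⟩ := hω.exists_arrivalTime_lt_lt
    obtain ⟨a, ha⟩ := (forall_dirAfter_emod_four_iff_exists_isZigzag hω.initial_mem hω.turn_mem n).1
      ((posX_add_posY_eq_iff hc hω.waiting_pos ht hn hn').1 hside)
    rw [ha.posX_sub_posY_eq a.2 hω.waiting_pos ht hn.le hn'] at hmem
    cases n with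
    | zero =>
      have hvertex := hB hmem
      rcases neg_one_pow_eq_or ℝ (a : ℕ) with hsign | hsign <;>
        simp [sideCoord, oppositeIndices, hsign] at hvertex
    | succ n => exact ⟨(n, a), ha, hmem, hn, hn'⟩
  · rintro ⟨⟨n, a⟩, ha, hmem, hn, hn'⟩
    refine ⟨(posX_add_posY_eq_iff hc hω.waiting_pos ht hn hn').2 ?_, ?_⟩
    · exact (forall_dirAfter_emod_four_iff_exists_isZigzag hω.initial_mem hω.turn_mem _).2 ⟨a, ha⟩
    · rwa [ha.posX_sub_posY_eq a.2 hω.waiting_pos ht hn.le hn']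

lemma IsRegularPath.eq_of_mem_zigzagEvent (hω : IsRegularPath J₀ W E t ω) {i j : ℕ × Fin 2}
    {C D : Set ℝ} (hi : ω ∈ zigzagEvent J₀ W E t i.2 (i.1 + 1) C)
    (hj : ω ∈ zigzagEvent J₀ W E t j.2 (j.1 + 1) D) : i = j := by
  have hcount := eq_of_arrivalTime_lt_lt hω.waiting_pos hi.2.2 hj.2.2
  exact Prod.ext (Nat.succ_injective hcount) (hi.1.initial_unique hj.1)

end RegularPaths

section Probability

variable [MeasurableSpace Ω] {P : Measure Ω} {lam p q t : ℝ} {J₀ : Ω → ℤ} {W : ℕ → Ω → ℝ}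
  {E : ℕ → Ω → ℤ}

lemma uniformOn_singleton_of_fin_two (a : Fin 2) :
    uniformOn ({0, 1, 2, 3} : Set ℤ) {((a : ℕ) : ℤ)} = ENNReal.ofReal (1 / 4) := by
  have h := uniformOn_apply_finset (s := ({0, 1, 2, 3} : Finset ℤ)) (t := {((a : ℕ) : ℤ)})
  have hinter : (({0, 1, 2, 3} : Finset ℤ) ∩ {((a : ℕ) : ℤ)}).card = 1 := by
    fin_cases a <;> rfl
  rw [hinter, show ({0, 1, 2, 3} : Finset ℤ).card = 4 from rfl] at h
  push_cast at h
  rw [h, ENNReal.ofReal_div_of_pos (by norm_num)]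
  simp

lemma turnLaw_neg_one_pow (p q : ℝ) (m : ℕ) :
    turnLaw p q {(-1) ^ m} = ENNReal.ofReal (if Even m then p else q) := by
  rcases Nat.even_or_odd m with h | h
  · simp [turnLaw, h.neg_one_pow, h]
  · simp [turnLaw, h.neg_one_pow, Nat.not_even_iff_odd.2 h]

/-- The probability that the first `n` turns are those of a zigzag path that starts in direction
`d_a`. -/
def turnWeight (p q : ℝ) (a n : ℕ) : ℝ := ∏ k ∈ Finset.range n, if Even (k + a) then p else q

lemma measure_turns_eq (hp : 0 ≤ p) (hq : 0 ≤ q) (hE : ∀ k, HasLaw (E k) (turnLaw p q) P)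
    (hindep : iIndepFun E P) (a n : ℕ) :
    P {ω | ∀ k < n, E k ω = (-1) ^ (k + a)} = ENNReal.ofReal (turnWeight p q a n) := by
  have hset : {ω | ∀ k < n, E k ω = (-1) ^ (k + a)} =
      ⋂ k ∈ Finset.range n, E k ⁻¹' {(-1) ^ (k + a)} := by
    ext ω
    simp
  rw [hset, hindep.measure_inter_preimage_eq_mul _ fun k _ => measurableSet_singleton _,
    turnWeight, ENNReal.ofReal_prod_of_nonneg fun k _ => by split_ifs <;> assumption]
  refine Finset.prod_congr rfl fun k _ => ?_
  rw [← turnLaw_neg_one_pow]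
  exact (hE k).measure_eq (measurableSet_singleton _)

lemma IsDriving.measure_isZigzag_inter_waiting_mem (hd : IsDriving P lam p q J₀ W E) (hp : 0 ≤ p)
    (hq : 0 ≤ q) (a : Fin 2) (n : ℕ) {S : Set (ℕ → ℝ)} (hS : MeasurableSet S) :
    P {ω | IsZigzag J₀ E a n ω ∧ (fun i => W i ω) ∈ S} =
      ENNReal.ofReal (1 / 4 * turnWeight p q a n) * P {ω | (fun i => W i ω) ∈ S} := by
  set R : Set (ℕ → ℤ) := {e | ∀ k < n, e k = (-1) ^ (k + a : ℕ)} with hR_def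
  have hR : MeasurableSet R := by
    simp only [hR_def, Set.ofPred_forall]
    measurability
  have hinit : P (J₀ ⁻¹' {((a : ℕ) : ℤ)}) = ENNReal.ofReal (1 / 4) := by
    rw [← uniformOn_singleton_of_fin_two a]
    exact hd.initial_law.measure_eq (measurableSet_singleton _)
  calc P {ω | IsZigzag J₀ E a n ω ∧ (fun i => W i ω) ∈ S}
    _ = P (J₀ ⁻¹' {((a : ℕ) : ℤ)} ∩
          (fun ω => ((fun i => W i ω), fun i => E i ω)) ⁻¹' (S ×ˢ R)) := by
      congr 1
      ext ω
      exact ⟨fun h => ⟨h.1.initial_eq, h.2, h.1.turn_eq⟩, fun h => ⟨⟨h.1, h.2.2⟩, h.2.1⟩⟩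
    _ = P (J₀ ⁻¹' {((a : ℕ) : ℤ)}) * (P ((fun ω i => W i ω) ⁻¹' S) *
          P ((fun ω i => E i ω) ⁻¹' R)) := by
      rw [hd.initial_indep.measure_inter_preimage_eq_mul _ _ (measurableSet_singleton _)
        (hS.prod hR), ← hd.waiting_turn_indep.measure_inter_preimage_eq_mul _ _ hS hR]
      rfl
    _ = ENNReal.ofReal (1 / 4 * turnWeight p q a n) * P {ω | (fun i => W i ω) ∈ S} := by
      have hturns : P ((fun ω i => E i ω) ⁻¹' R) = ENNReal.ofReal (turnWeight p q a n) :=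
        measure_turns_eq hp hq hd.turn_law hd.turn_indep a n
      rw [hinit, hturns, ENNReal.ofReal_mul (by norm_num), mul_comm (P _), mul_assoc]
      rfl

lemma IsDriving.measure_zigzagEvent [IsProbabilityMeasure P] (hd : IsDriving P lam p q J₀ W E)
    (hlam : 0 < lam) (hp : 0 ≤ p) (hq : 0 ≤ q) (a : Fin 2) (n : ℕ) {C : Set ℝ}
    (hC : MeasurableSet C) (hCt : C ⊆ Set.Iio t) :
    P (zigzagEvent J₀ W E t a (n + 1) C) = ENNReal.ofReal (1 / 4 * turnWeight p q a (n + 1)) *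
      ∫⁻ x in C, gammaPDF ((n / 2 : ℕ) + 1) lam x *
        (ENNReal.ofReal lam⁻¹ * gammaPDF (((n + 1) / 2 : ℕ) + 1) lam (t - x)) := by
  have hsame := (card_sameIndices_and_card_oppositeIndices (n + 1)).1
  have hopp : (oppositeIndices (n + 1)).card = n / 2 + 1 := by
    rw [(card_sameIndices_and_card_oppositeIndices (n + 1)).2]
    lia
  have hsum : ∀ s : Finset ℕ, Measurable fun w : ℕ → ℝ => ∑ i ∈ s, w i := fun s => by fun_prop
  have hwaiting := measure_sum_mem_and_add_sum_lt_lt (n := n + 1) hlam hd.waiting_law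
    hd.waiting_indep (Finset.card_pos.1 (hopp ▸ Nat.succ_pos _))
    (disjoint_oppositeIndices_sameIndices (n + 1)) (by simp [oppositeIndices])
    (by simp [sameIndices]) hC hCt
  simp only [sum_oppositeIndices_add_sum_sameIndices, ← Finset.sum_range_succ] at hwaiting
  rw [hsame, hopp, Nat.cast_add_one (n / 2)] at hwaiting
  rw [← hwaiting]
  exact hd.measure_isZigzag_inter_waiting_mem hp hq a (n + 1)
    (S := {w | ∑ i ∈ oppositeIndices (n + 1), w i ∈ C ∧ ∑ i ∈ Finset.range (n + 1), w i < t ∧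
      t < ∑ i ∈ Finset.range (n + 1 + 1), w i})
    ((hC.preimage (hsum _)).inter <| (measurableSet_lt (hsum _) measurable_const).inter <|
      measurableSet_lt measurable_const (hsum _))

lemma ae_turnLaw_mem (p q : ℝ) : ∀ᵐ j ∂(turnLaw p q), j ∈ ({1, -1, 2} : Set ℤ) := by
  rw [ae_iff]
  simp [turnLaw]

lemma IsDriving.ae_isRegularPath [IsProbabilityMeasure P] (hd : IsDriving P lam p q J₀ W E)
    (hlam : 0 < lam) (ht : 0 < t) : ∀ᵐ ω ∂P, IsRegularPath J₀ W E t ω := by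
  have hinit : ∀ᵐ ω ∂P, J₀ ω ∈ ({0, 1, 2, 3} : Set ℤ) :=
    (hd.initial_law.ae_iff (by measurability)).2 (ae_cond_mem (by measurability))
  have hturn : ∀ᵐ ω ∂P, ∀ k, E k ω ∈ ({1, -1, 2} : Set ℤ) :=
    ae_all_iff.2 fun k => ((hd.turn_law k).ae_iff (by measurability)).2 (ae_turnLaw_mem p q)
  filter_upwards [ae_waiting_pos hd.waiting_law, hinit, hturn,
    ae_exists_arrivalTime_lt_lt hlam hd.waiting_law hd.waiting_indep ht] with ω hpos hJ hE hn
  exact ⟨hpos, hn, hJ, hE⟩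

lemma IsDriving.aemeasurable_integral_comp_dirIndex [IsProbabilityMeasure P]
    (hd : IsDriving P lam p q J₀ W E) (hlam : 0 < lam) (ht : 0 < t) (G : ℤ → ℝ) :
    AEMeasurable (fun ω => ∫ s in (0 : ℝ)..t, G (dirIndex J₀ W E s ω)) P := by
  have hJ := hd.initial_law.aemeasurable
  have hE := fun k => (hd.turn_law k).aemeasurable
  have hT := aemeasurable_arrivalTime fun n => (hd.waiting_law n).aemeasurable
  refine aemeasurable_of_tendsto_metrizable_ae Filter.atTop (f := fun m ω =>
    ∑ k ∈ Finset.range m, G (dirAfter J₀ E k ω) * sojourn W t k ω) (fun m => ?_) ?_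
  · have hdir : ∀ k, AEMeasurable (dirAfter J₀ E k) P := fun k =>
      hJ.add (Finset.aemeasurable_fun_sum _ fun i _ => hE i)
    exact Finset.aemeasurable_fun_sum _ fun k _ =>
      ((measurable_of_countable G).comp_aemeasurable (hdir k)).mul
        (((hT (k + 1)).min aemeasurable_const).sub ((hT k).min aemeasurable_const))
  · filter_upwards [hd.ae_isRegularPath hlam ht] with ω hω
    obtain ⟨n, -, hn⟩ := hω.exists_arrivalTime_lt_lt
    refine tendsto_const_nhds.congr' ?_
    filter_upwards [Filter.eventually_ge_atTop (n + 1)] with m hm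
    exact integral_comp_dirIndex hω.waiting_pos ht.le
      (hn.le.trans ((strictMono_arrivalTime hω.waiting_pos).monotone hm)) G

end Probability

section Bessel

variable {c lam p q η t : ℝ}

/-- The Bessel–Clifford function `∑ zᵏ / (k! (k + n)!)` of order `n`, in terms of which
`I₀ x = besselClifford 0 ((x / 2) ^ 2)`. -/
def besselClifford (n : ℕ) (z : ℝ) : ℝ :=
  ∑' k : ℕ, z ^ k / ((k.factorial : ℝ) * ((k + n).factorial : ℝ))

lemma summable_besselClifford (n : ℕ) (z : ℝ) :
    Summable fun k : ℕ => z ^ k / ((k.factorial : ℝ) * ((k + n).factorial : ℝ)) := by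
  refine Summable.of_norm_bounded (Real.summable_pow_div_factorial |z|) fun k => ?_
  have hfact : (1 : ℝ) ≤ ((k + n).factorial : ℝ) := by exact_mod_cast (k + n).factorial_pos
  rw [norm_div, norm_pow, Real.norm_eq_abs, Real.norm_of_nonneg (by positivity)]
  gcongr
  exact le_mul_of_one_le_right (by positivity) hfact

lemma besselClifford_nonneg (n : ℕ) {z : ℝ} (hz : 0 ≤ z) : 0 ≤ besselClifford n z :=
  tsum_nonneg fun _ => by positivity

lemma succ_mul_pow_div_factorial_mul_factorial (n k : ℕ) (z : ℝ) :
    ((k + 1 : ℕ) : ℝ) * z ^ (k + 1 - 1) /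
        (((k + 1).factorial : ℝ) * ((k + 1 + n).factorial : ℝ)) =
      z ^ k / ((k.factorial : ℝ) * ((k + (n + 1)).factorial : ℝ)) := by
  rw [Nat.factorial_succ k, add_right_comm k 1 n, add_assoc k n 1, Nat.add_sub_cancel]
  push_cast
  field_simp

lemma hasDerivAt_besselClifford (n : ℕ) (z : ℝ) :
    HasDerivAt (besselClifford n) (besselClifford (n + 1) z) z := by
  have hsummable (x : ℝ) : Summable fun k : ℕ =>
      k * x ^ (k - 1) / ((k.factorial : ℝ) * ((k + n).factorial : ℝ)) := by
    rw [← summable_nat_add_iff 1]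
    simpa only [succ_mul_pow_div_factorial_mul_factorial] using summable_besselClifford (n + 1) x
  have hderiv := hasDerivAt_tsum_of_isPreconnected (y₀ := 0) (y := z)
    (g := fun (k : ℕ) (x : ℝ) => x ^ k / ((k.factorial : ℝ) * ((k + n).factorial : ℝ)))
    (hsummable (|z| + 1)) Metric.isOpen_ball (convex_ball (0 : ℝ) (|z| + 1)).isPreconnected
    (fun k x _ => (hasDerivAt_pow k x).div_const _)
    (fun k x hx => by
      have hx' : |x| ≤ |z| + 1 := by simpa using (Metric.mem_ball.1 hx).le
      rw [norm_div, norm_mul, norm_pow, Real.norm_eq_abs x, RCLike.norm_natCast,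
        Real.norm_of_nonneg (by positivity)]
      gcongr)
    (Metric.mem_ball_self (by positivity)) (summable_besselClifford n 0) (by simp)
  rw [(hsummable z).tsum_eq_zero_add] at hderiv
  simp only [succ_mul_pow_div_factorial_mul_factorial, Nat.cast_zero, zero_mul, zero_div,
    zero_add] at hderiv
  exact hderiv

/-- The square of half the argument of `I₀` in the density. -/
def halfArgSq (c lam p q η t : ℝ) : ℝ := lam ^ 2 * (p * q) * ((c ^ 2 * t ^ 2 - η ^ 2) / (4 * c ^ 2))

lemma besselProfile_eq_besselClifford (hpq : 0 ≤ p * q) (ht : 0 ≤ c ^ 2 * t ^ 2 - η ^ 2) :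
    besselProfile c lam p q η t = besselClifford 0 (halfArgSq c lam p q η t) := by
  rw [besselProfile, besselI0, besselClifford]
  refine tsum_congr fun k => ?_
  rw [pow_mul, div_pow, mul_pow, mul_pow, Real.sq_sqrt hpq, Real.sq_sqrt ht, halfArgSq, add_zero,
    ← sq]
  ring

lemma hasDerivAt_halfArgSq (hc : c ≠ 0) :
    HasDerivAt (fun s => halfArgSq c lam p q η s) (lam ^ 2 * (p * q) * (t / 2)) t := by
  have h := ((((hasDerivAt_pow 2 t).const_mul (c ^ 2)).sub_const (η ^ 2)).div_const
    (4 * c ^ 2)).const_mul (lam ^ 2 * (p * q))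
  convert! h using 2
  push_cast
  field_simp
  ring

lemma sq_mul_sq_sub_sq_pos (hη : |η| < c * t) : 0 < c ^ 2 * t ^ 2 - η ^ 2 := by
  rw [← mul_pow, sub_pos, sq_lt_sq]
  exact hη.trans_le (le_abs_self _)

lemma hasDerivAt_besselProfile (hc : c ≠ 0) (hpq : 0 ≤ p * q) (hη : |η| < c * t) :
    HasDerivAt (fun s => besselProfile c lam p q η s)
      (besselClifford 1 (halfArgSq c lam p q η t) * (lam ^ 2 * (p * q) * (t / 2))) t := by
  have hpos : ∀ᶠ s in nhds t, 0 < c ^ 2 * s ^ 2 - η ^ 2 :=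
    (by fun_prop : Continuous fun s => c ^ 2 * s ^ 2 - η ^ 2).continuousAt.eventually
      (lt_mem_nhds (sq_mul_sq_sub_sq_pos hη))
  refine ((hasDerivAt_besselClifford 0 _).comp t (hasDerivAt_halfArgSq hc)).congr_of_eventuallyEq ?_
  filter_upwards [hpos] with s hs
  exact besselProfile_eq_besselClifford hpq hs.le

lemma sideDensity_eq_besselClifford (hc : c ≠ 0) (hpq : 0 ≤ p * q) (hη : |η| < c * t) :
    sideDensity c lam p q η t = Real.exp (-(lam * t)) / (4 * c) *
      (lam * (p + q) / 2 * besselClifford 0 (halfArgSq c lam p q η t) +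
        lam ^ 2 * (p * q) * (t / 2) * besselClifford 1 (halfArgSq c lam p q η t)) := by
  rw [sideDensity, (hasDerivAt_besselProfile hc hpq hη).deriv,
    besselProfile_eq_besselClifford hpq (sq_mul_sq_sub_sq_pos hη).le, neg_mul, mul_comm
    (besselClifford 1 _)]

lemma sideDensity_nonneg (hc : 0 < c) (hlam : 0 ≤ lam) (hp : 0 ≤ p) (hq : 0 ≤ q)
    (hη : |η| < c * t) : 0 ≤ sideDensity c lam p q η t := by
  have ht : 0 < t := pos_of_mul_pos_right ((abs_nonneg η).trans_lt hη) hc.le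
  have hz : 0 ≤ halfArgSq c lam p q η t := by
    have := sq_mul_sq_sub_sq_pos hη
    rw [halfArgSq]
    positivity
  have := besselClifford_nonneg 0 hz
  have := besselClifford_nonneg 1 hz
  rw [sideDensity_eq_besselClifford hc.ne' (mul_nonneg hp hq) hη]
  positivity

end Bessel

section Density

variable {c lam p q η t : ℝ}

/-- The density of `X(t) - Y(t)` on the paths of `zigzagEvent` with `n + 1` turns and initial
direction `d_a`. -/
def zigzagDensity (c lam p q t : ℝ) (a n : ℕ) (η : ℝ) : ℝ :=
  1 / 4 * turnWeight p q a (n + 1) * (1 / (2 * c)) *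
    (lam ^ (n + 1) / ((n / 2).factorial * ((n + 1) / 2).factorial) *
      oppositeTime c t a (n + 1) η ^ (n / 2) *
      (t - oppositeTime c t a (n + 1) η) ^ ((n + 1) / 2) * Real.exp (-(lam * t)))

lemma turnWeight_two_mul (p q : ℝ) (a m : ℕ) : turnWeight p q a (2 * m) = (p * q) ^ m := by
  induction m with
  | zero => simp [turnWeight]
  | succ m ih =>
    rw [turnWeight] at ih ⊢
    rw [Nat.mul_succ, Finset.prod_range_succ, Finset.prod_range_succ, ih, pow_succ]
    rcases Nat.even_or_odd a with ha | ha
    · rw [if_pos (by grind), if_neg (by grind)]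
      ring
    · rw [if_neg (by grind), if_pos (by grind)]
      ring

lemma turnWeight_two_mul_add_one (p q : ℝ) (a m : ℕ) :
    turnWeight p q a (2 * m + 1) = (p * q) ^ m * if Even a then p else q := by
  have heven : Even (2 * m + a) ↔ Even a := by grind
  rw [turnWeight, Finset.prod_range_succ, ← turnWeight, turnWeight_two_mul, if_congr heven rfl rfl]

lemma turnWeight_nonneg (hp : 0 ≤ p) (hq : 0 ≤ q) (a n : ℕ) : 0 ≤ turnWeight p q a n :=
  Finset.prod_nonneg fun _ _ => by split_ifs <;> assumption

lemma neg_one_pow_mul_neg_one_pow_self (m : ℕ) : (-1 : ℝ) ^ m * (-1) ^ m = 1 := by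
  rw [← mul_pow]
  norm_num

lemma oppositeTime_mul_sub (hc : c ≠ 0) (t : ℝ) (a n : ℕ) (η : ℝ) :
    oppositeTime c t a n η * (t - oppositeTime c t a n η) =
      (c ^ 2 * t ^ 2 - η ^ 2) / (4 * c ^ 2) := by
  have hsign := neg_one_pow_mul_neg_one_pow_self (n + a)
  rw [oppositeTime]
  field_simp
  linear_combination (-4 * η ^ 2) * hsign

lemma oppositeTime_zero_add_oppositeTime_one (c t : ℝ) (n : ℕ) (η : ℝ) :
    oppositeTime c t 0 n η + oppositeTime c t 1 n η = t := by
  rw [oppositeTime, oppositeTime, add_zero, pow_succ]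
  ring

lemma sideCoord_oppositeTime (hc : c ≠ 0) (t : ℝ) (a n : ℕ) (η : ℝ) :
    sideCoord c t a n (oppositeTime c t a n η) = η := by
  have hsign := neg_one_pow_mul_neg_one_pow_self (n + a)
  rw [sideCoord, oppositeTime]
  field_simp
  linear_combination η * hsign

lemma oppositeTime_mem_Ioo (hc : 0 < c) (hη : |η| < c * t) (a n : ℕ) :
    oppositeTime c t a n η ∈ Set.Ioo 0 t := by
  have h : |(-1) ^ (n + a) * η / c| < t := by
    rw [abs_div, abs_mul, abs_neg_one_pow, one_mul, abs_of_pos hc, div_lt_iff₀ hc]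
    linarith
  rw [abs_lt] at h
  constructor <;> rw [oppositeTime] <;> linarith

lemma zigzagDensity_nonneg (hc : 0 < c) (hlam : 0 ≤ lam) (hp : 0 ≤ p) (hq : 0 ≤ q)
    (hη : |η| < c * t) (a n : ℕ) : 0 ≤ zigzagDensity c lam p q t a n η := by
  obtain ⟨hx, hxt⟩ := oppositeTime_mem_Ioo hc hη a (n + 1)
  have := sub_pos.2 hxt
  have := turnWeight_nonneg hp hq a (n + 1)
  rw [zigzagDensity]
  positivity

lemma measurable_zigzagDensity (c lam p q t : ℝ) (a n : ℕ) :
    Measurable (zigzagDensity c lam p q t a n) := by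
  unfold zigzagDensity oppositeTime
  fun_prop

lemma sum_zigzagDensity_two_mul (hc : c ≠ 0) (lam p q t η : ℝ) (m : ℕ) :
    ∑ a : Fin 2, zigzagDensity c lam p q t a (2 * m) η =
      Real.exp (-(lam * t)) / (4 * c) * (lam * (p + q) / 2) *
        (halfArgSq c lam p q η t ^ m / (m.factorial * (m + 0).factorial)) := by
  have hterm (a : Fin 2) : zigzagDensity c lam p q t a (2 * m) η =
      Real.exp (-(lam * t)) / (4 * c) * (lam * (if Even (a : ℕ) then p else q) / 2) *
        (halfArgSq c lam p q η t ^ m / (m.factorial * (m + 0).factorial)) := by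
    rw [zigzagDensity, turnWeight_two_mul_add_one, show 2 * m / 2 = m by lia,
      show (2 * m + 1) / 2 = m by lia, halfArgSq, ← oppositeTime_mul_sub hc t a (2 * m + 1)]
    simp only [mul_pow, pow_succ, pow_mul, add_zero]
    field_simp
  rw [Fin.sum_univ_two, hterm, hterm]
  simp
  ring

lemma sum_zigzagDensity_two_mul_add_one (hc : c ≠ 0) (lam p q t η : ℝ) (m : ℕ) :
    ∑ a : Fin 2, zigzagDensity c lam p q t a (2 * m + 1) η =
      Real.exp (-(lam * t)) / (4 * c) * (lam ^ 2 * (p * q) * (t / 2)) *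
        (halfArgSq c lam p q η t ^ m / (m.factorial * (m + 1).factorial)) := by
  have hterm (a : Fin 2) : zigzagDensity c lam p q t a (2 * m + 1) η =
      Real.exp (-(lam * t)) / (4 * c) * (lam ^ 2 * (p * q) / 2) *
        (halfArgSq c lam p q η t ^ m / (m.factorial * (m + 1).factorial)) *
          (t - oppositeTime c t a (2 * (m + 1)) η) := by
    rw [zigzagDensity, show 2 * m + 1 + 1 = 2 * (m + 1) by lia, turnWeight_two_mul,
      show (2 * m + 1) / 2 = m by lia, show 2 * (m + 1) / 2 = m + 1 by lia, halfArgSq,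
      ← oppositeTime_mul_sub hc t a (2 * (m + 1))]
    simp only [mul_pow, pow_succ, pow_mul]
    field_simp
  have hsum := oppositeTime_zero_add_oppositeTime_one c t (2 * (m + 1)) η
  rw [Fin.sum_univ_two, hterm, hterm, ← mul_add, Fin.val_zero, Fin.val_one]
  have hsub : t - oppositeTime c t 0 (2 * (m + 1)) η + (t - oppositeTime c t 1 (2 * (m + 1)) η) =
      t := by linarith
  rw [hsub]
  ring

lemma hasSum_zigzagDensity (hc : c ≠ 0) (hpq : 0 ≤ p * q) (hη : |η| < c * t) :
    HasSum (fun n => ∑ a : Fin 2, zigzagDensity c lam p q t a n η)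
      (sideDensity c lam p q η t) := by
  rw [sideDensity_eq_besselClifford hc hpq hη, mul_add, ← mul_assoc, ← mul_assoc]
  refine HasSum.even_add_odd ?_ ?_
  · simp only [sum_zigzagDensity_two_mul hc]
    exact (summable_besselClifford 0 _).hasSum.mul_left _
  · simp only [sum_zigzagDensity_two_mul_add_one hc]
    exact (summable_besselClifford 1 _).hasSum.mul_left _

lemma tsum_ofReal_zigzagDensity (hc : 0 < c) (hlam : 0 ≤ lam) (hp : 0 ≤ p) (hq : 0 ≤ q)
    (hη : |η| < c * t) :
    ∑' i : ℕ × Fin 2, ENNReal.ofReal (zigzagDensity c lam p q t i.2 i.1 η) =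
      ENNReal.ofReal (sideDensity c lam p q η t) := by
  have hnonneg (n : ℕ) (a : Fin 2) : 0 ≤ zigzagDensity c lam p q t a n η :=
    zigzagDensity_nonneg hc hlam hp hq hη a n
  have hsum := hasSum_zigzagDensity (lam := lam) hc.ne' (mul_nonneg hp hq) hη
  calc ∑' i : ℕ × Fin 2, ENNReal.ofReal (zigzagDensity c lam p q t i.2 i.1 η)
    _ = ∑' n, ∑' a : Fin 2, ENNReal.ofReal (zigzagDensity c lam p q t a n η) :=
      ENNReal.tsum_prod'
    _ = ∑' n, ENNReal.ofReal (∑ a : Fin 2, zigzagDensity c lam p q t a n η) :=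
      tsum_congr fun n => by
        rw [tsum_fintype, ENNReal.ofReal_sum_of_nonneg fun a _ => hnonneg n a]
    _ = ENNReal.ofReal (sideDensity c lam p q η t) := by
      rw [← ENNReal.ofReal_tsum_of_nonneg
        (fun n => Finset.sum_nonneg fun a _ => hnonneg n a) hsum.summable, hsum.tsum_eq]

lemma setLIntegral_preimage_sideCoord (hc : 0 < c) {g : ℝ → ℝ≥0∞} (hg : Measurable g) {B : Set ℝ}
    (hB : MeasurableSet B) (t : ℝ) (a n : ℕ) :
    ∫⁻ x in sideCoord c t a n ⁻¹' B, g x =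
      ENNReal.ofReal (1 / (2 * c)) * ∫⁻ η in B, g (oppositeTime c t a n η) := by
  have hmeas : MeasurableSet (sideCoord c t a n ⁻¹' B) :=
    hB.preimage (by unfold sideCoord; fun_prop)
  have hslope : (-1) ^ (n + a) * (-1 / (2 * c)) ≠ 0 :=
    mul_ne_zero (pow_ne_zero _ (by norm_num)) (div_ne_zero (by norm_num) (by positivity))
  have habs : |(-1) ^ (n + a) * (-1 / (2 * c))| = 1 / (2 * c) := by
    rw [abs_mul, abs_neg_one_pow, one_mul, abs_div, abs_neg, abs_one, abs_of_pos (by positivity)]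
  rw [← lintegral_indicator hmeas, ← lintegral_indicator hB,
    lintegral_eq_mul_lintegral_comp_mul_left_add (hg.indicator hmeas) hslope (t / 2), habs]
  congr 2
  ext η
  have htime : (-1) ^ (n + a) * (-1 / (2 * c)) * η + t / 2 = oppositeTime c t a n η := by
    rw [oppositeTime]
    field_simp
    ring
  have hmem : oppositeTime c t a n η ∈ sideCoord c t a n ⁻¹' B ↔ η ∈ B := by
    rw [Set.mem_preimage, sideCoord_oppositeTime hc.ne']
  classical
  rw [htime, Set.indicator_apply, Set.indicator_apply, if_congr hmem rfl rfl]

lemma preimage_sideCoord_subset_Iio (hc : 0 < c) {B : Set ℝ}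
    (hB : B ⊆ Set.Ioo (-(c * t)) (c * t)) (a n : ℕ) : sideCoord c t a n ⁻¹' B ⊆ Set.Iio t := by
  intro x hx
  have h : |sideCoord c t a n x| < c * t := abs_lt.2 (hB hx)
  rw [sideCoord, abs_mul, abs_mul, abs_neg_one_pow, mul_one, abs_of_pos hc,
    mul_lt_mul_iff_right₀ hc, abs_lt] at h
  exact Set.mem_Iio.2 (by linarith)

variable [MeasurableSpace Ω] {P : Measure Ω} {J₀ : Ω → ℤ} {W : ℕ → Ω → ℝ} {E : ℕ → Ω → ℤ}

lemma IsDriving.measure_zigzagEvent_preimage_sideCoord [IsProbabilityMeasure P]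
    (hd : IsDriving P lam p q J₀ W E) (hc : 0 < c) (hlam : 0 < lam) (hp : 0 ≤ p) (hq : 0 ≤ q)
    {B : Set ℝ} (hB : MeasurableSet B) (hBt : B ⊆ Set.Ioo (-(c * t)) (c * t)) (a : Fin 2) (n : ℕ) :
    P (zigzagEvent J₀ W E t a (n + 1) (sideCoord c t a (n + 1) ⁻¹' B)) =
      ∫⁻ η in B, ENNReal.ofReal (zigzagDensity c lam p q t a n η) := by
  have hmeas : Measurable fun x => gammaPDF ((n / 2 : ℕ) + 1) lam x *
      (ENNReal.ofReal lam⁻¹ * gammaPDF (((n + 1) / 2 : ℕ) + 1) lam (t - x)) :=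
    (measurable_gammaPDF _ _).mul
      (((measurable_gammaPDF _ _).comp (measurable_const.sub measurable_id)).const_mul _)
  have hweight := turnWeight_nonneg hp hq a (n + 1)
  rw [hd.measure_zigzagEvent hlam hp hq a n (hB.preimage (by unfold sideCoord; fun_prop))
    (preimage_sideCoord_subset_Iio hc hBt a (n + 1)), setLIntegral_preimage_sideCoord hc hmeas hB,
    ← mul_assoc, ← ENNReal.ofReal_mul (by positivity),
    ← lintegral_const_mul' _ _ ENNReal.ofReal_ne_top]
  refine setLIntegral_congr_fun hB fun η hη => ?_
  obtain ⟨hx, hxt⟩ := oppositeTime_mem_Ioo hc (abs_lt.2 (hBt hη)) a (n + 1)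
  rw [gammaPDF_mul_inv_mul_gammaPDF hlam _ _ hx.le (sub_pos.2 hxt).le,
    ← ENNReal.ofReal_mul (by positivity), zigzagDensity, add_sub_cancel,
    show n / 2 + (n + 1) / 2 = n by lia]

lemma IsDriving.nullMeasurableSet_zigzagEvent (hd : IsDriving P lam p q J₀ W E) (t : ℝ) (a n : ℕ)
    {C : Set ℝ} (hC : MeasurableSet C) : NullMeasurableSet (zigzagEvent J₀ W E t a n C) P := by
  have hW := fun i => (hd.waiting_law i).aemeasurable
  have hT := aemeasurable_arrivalTime hW
  have hzigzag : NullMeasurableSet {ω | IsZigzag J₀ E a n ω} P := by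
    have hset : {ω | IsZigzag J₀ E a n ω} =
        J₀ ⁻¹' {(a : ℤ)} ∩ ⋂ k < n, E k ⁻¹' {(-1) ^ (k + a)} := by
      ext ω
      simpa using ⟨fun h => ⟨h.initial_eq, h.turn_eq⟩, fun h => ⟨h.1, h.2⟩⟩
    rw [hset]
    exact (hd.initial_law.aemeasurable.nullMeasurable (measurableSet_singleton _)).inter <|
      .iInter fun k => .iInter fun _ =>
        (hd.turn_law k).aemeasurable.nullMeasurable (measurableSet_singleton _)
  exact hzigzag.inter <|
    ((Finset.aemeasurable_fun_sum _ fun i _ => hW i).nullMeasurable hC).inter <|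
      (nullMeasurableSet_lt (hT n) aemeasurable_const).inter <|
        nullMeasurableSet_lt aemeasurable_const (hT (n + 1))

theorem IsDriving.measure_side_eq_setLIntegral_sideDensity [IsProbabilityMeasure P]
    (hd : IsDriving P lam p q J₀ W E) (hc : 0 < c) (hlam : 0 < lam) (hp : 0 ≤ p) (hq : 0 ≤ q)
    (ht : 0 < t) {B : Set ℝ} (hB : MeasurableSet B) (hBt : B ⊆ Set.Ioo (-(c * t)) (c * t)) :
    P {ω | posX c J₀ W E t ω + posY c J₀ W E t ω = c * t ∧
        posX c J₀ W E t ω - posY c J₀ W E t ω ∈ B} =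
      ∫⁻ η in B, ENNReal.ofReal (sideDensity c lam p q η t) := by
  have hregular := hd.ae_isRegularPath hlam ht
  let A (i : ℕ × Fin 2) : Set Ω :=
    zigzagEvent J₀ W E t i.2 (i.1 + 1) (sideCoord c t i.2 (i.1 + 1) ⁻¹' B)
  have hA (i : ℕ × Fin 2) : NullMeasurableSet (A i) P :=
    hd.nullMeasurableSet_zigzagEvent t _ _ (hB.preimage (by unfold sideCoord; fun_prop))
  have hdisjoint : Pairwise (Function.onFun (AEDisjoint P) A) := fun i j hij => by
    refine measure_mono_null (fun ω hω => ?_) (ae_iff.1 hregular)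
    exact fun hreg => hij (hreg.eq_of_mem_zigzagEvent hω.1 hω.2)
  calc P {ω | posX c J₀ W E t ω + posY c J₀ W E t ω = c * t ∧
          posX c J₀ W E t ω - posY c J₀ W E t ω ∈ B}
    _ = P (⋃ i, A i) := by
      refine measure_congr (Filter.eventuallyEq_set.2 ?_)
      filter_upwards [hregular] with ω hω
      exact (hω.posX_posY_mem_side_iff hc ht.le hBt).trans Set.mem_iUnion.symm
    _ = ∑' i, P (A i) := measure_iUnion₀ hdisjoint hA
    _ = ∑' i : ℕ × Fin 2, ∫⁻ η in B, ENNReal.ofReal (zigzagDensity c lam p q t i.2 i.1 η) :=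
      tsum_congr fun i => hd.measure_zigzagEvent_preimage_sideCoord hc hlam hp hq hB hBt i.2 i.1
    _ = ∫⁻ η in B, ∑' i : ℕ × Fin 2, ENNReal.ofReal (zigzagDensity c lam p q t i.2 i.1 η) :=
      (lintegral_tsum fun i => (measurable_zigzagDensity ..).ennreal_ofReal.aemeasurable).symm
    _ = ∫⁻ η in B, ENNReal.ofReal (sideDensity c lam p q η t) :=
      setLIntegral_congr_fun hB fun η hη =>
        tsum_ofReal_zigzagDensity hc hlam.le hp hq (abs_lt.2 (hBt hη))

end Density

end PlanarMotion

end

theorem mainTheorem4 {Ω : Type*} [MeasurableSpace Ω] (P : Measure Ω) [IsProbabilityMeasure P]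
    (c lam p q : ℝ) (hc : 0 < c) (hlam : 0 < lam) (hp : 0 ≤ p) (hq : 0 ≤ q) (hpq : p + q ≤ 1)
    (J₀ : Ω → ℤ) (W : ℕ → Ω → ℝ) (E : ℕ → Ω → ℤ)
    (hdrive : PlanarMotion.IsDriving P lam p q J₀ W E)
    (t : ℝ) (ht : 0 < t) :
    AEMeasurable (PlanarMotion.posX c J₀ W E t) P ∧
    AEMeasurable (PlanarMotion.posY c J₀ W E t) P ∧
    (∀ η : ℝ, |η| < c * t →
      DifferentiableAt ℝ (fun s => PlanarMotion.besselProfile c lam p q η s) t ∧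
      0 ≤ PlanarMotion.sideDensity c lam p q η t) ∧
    ∀ B : Set ℝ, MeasurableSet B → B ⊆ Set.Ioo (-(c * t)) (c * t) →
      P {ω | PlanarMotion.posX c J₀ W E t ω + PlanarMotion.posY c J₀ W E t ω = c * t ∧
            PlanarMotion.posX c J₀ W E t ω - PlanarMotion.posY c J₀ W E t ω ∈ B} =
        ∫⁻ η in B, ENNReal.ofReal (PlanarMotion.sideDensity c lam p q η t) := by
  refine ⟨hdrive.aemeasurable_integral_comp_dirIndex hlam ht fun j =>
      c * Real.cos (Real.pi / 2 * j), hdrive.aemeasurable_integral_comp_dirIndex hlam ht fun j =>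
      c * Real.sin (Real.pi / 2 * j), fun η hη => ⟨?_, ?_⟩, fun B hB hBt => ?_⟩
  · exact (PlanarMotion.hasDerivAt_besselProfile hc.ne' (mul_nonneg hp hq) hη).differentiableAt
  · exact PlanarMotion.sideDensity_nonneg hc hlam.le hp hq hη
  · exact hdrive.measure_side_eq_setLIntegral_sideDensity hc hlam hp hq ht hB hBt
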